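/- For integers $k\ge 1$ and $n\ge 0$, let $c\phi_k(n)$ denote the number of $k$-colored generalized Frobenius partitions of $n$, that is, the number of arrays $$\begin{pmatrix} r_{1,1} & r_{1,2} & \cdots & r_{1,d}\\ r_{2,1} & r_{2,2} & \cdots & r_{2,d}\end{pmatrix},\qquad d\ge 0,$$ whose entries are colored non-negative integers $\ell_c$ ($\ell\ge 0$, color $1\le c\le k$), whose rows are strictly decreasing with respect to the ordering $$0_1\prec 0_2\prec\cdots\prec 0_k\prec 1_1\prec 1_2\prec\cdots\prec 1_k\prec 2_1\prec\cdots,$$ and for which $n=d+\sum_{j=1}^d (r_{1,j}+r_{2,j})$, where an entry $\ell_c$ contributes $\ell$ to the sum. Set $c\phi_k(x)=0$ if $x$ is not an integer. **Theorem.** Let $p$ be a prime and let $N$ be a positive integer not divisible by $p$. For all integers $\alpha\ge 1$ and $n\ge 0$, $$c\phi_{p^{\alpha}N}(n)\equiv c\phi_{p^{\alpha-1}N}(n/p) \pmod{p^{2\alpha}}.$$ Equivalently, for all integers $\alpha\ge 1$ and $n\ge 0$, $$c\phi_{p^{\alpha}N}(pn+r)\equiv 0 \pmod{p^{2\alpha}}\quad\text{for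 } 1\le r\le p-1,$$ and $$c\phi_{p^{\alpha}N}(pn)\equiv c\phi_{p^{\alpha-1}N}(n)\pmod{p^{2\alpha}}.$$ -/

import Mathlib

/-- A `k`-colored generalized Frobenius symbol: a `2 × d` array (`d ≥ 0`) whose entries are
colored non-negative integers `ℓ_c`, with `c` one of `k` colors, such that both rows are strictly
decreasing for the ordering `0_1 ≺ ⋯ ≺ 0_k ≺ 1_1 ≺ ⋯ ≺ 1_k ≺ 2_1 ≺ ⋯`. The colored integer `ℓ_c`
is the pair `(ℓ, c)`, and the ordering is the lexicographic one on `ℕ ×ₗ Fin k`. -/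
structure ColoredFrobeniusSymbol (k : ℕ) where
  /-- the number of columns -/
  d : ℕ
  /-- the entries `row i j`, where `i` is the row and `j` is the column -/
  row : Fin 2 → Fin d → ℕ ×ₗ Fin k
  /-- each row is strictly decreasing -/
  row_strictAnti : ∀ i, StrictAnti (row i)

namespace ColoredFrobeniusSymbol

/-- The integer `n = d + ∑_j (r_{1,j} + r_{2,j})` attached to a symbol, where an entry `ℓ_c`
contributes `ℓ`. -/
def size {k : ℕ} (s : ColoredFrobeniusSymbol k) : ℕ :=
  s.d + ∑ j : Fin s.d, ((ofLex (s.row 0 j)).1 + (ofLex (s.row 1 j)).1)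

/-- There are only finitely many symbols of a given size, so that counting them with `Nat.card`
is meaningful. -/
instance finite_size_eq (k n : ℕ) :
    Finite {s : ColoredFrobeniusSymbol k // s.size = n} := by
  have hd : ∀ s : ColoredFrobeniusSymbol k, s.d < s.size + 1 := fun s => by
    unfold size; omega
  have hr : ∀ (s : ColoredFrobeniusSymbol k) (i : Fin 2) (j : Fin s.d),
      (ofLex (s.row i j)).1 < s.size + 1 := by
    intro s i j
    have h := Finset.single_le_sum
      (f := fun j : Fin s.d => (ofLex (s.row 0 j)).1 + (ofLex (s.row 1 j)).1)
      (fun _ _ => Nat.zero_le _) (Finset.mem_univ j)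
    unfold size
    fin_cases i <;> simp <;> omega
  let f : {s : ColoredFrobeniusSymbol k // s.size = n} →
      (Σ d : Fin (n + 1), Fin 2 → Fin d → Fin (n + 1) × Fin k) := fun s =>
    ⟨⟨s.1.d, by have := hd s.1; rwa [s.2] at this⟩, fun i j =>
      (⟨(ofLex (s.1.row i j)).1, by have := hr s.1 i j; rwa [s.2] at this⟩, (ofLex (s.1.row i j)).2)⟩
  refine Finite.of_injective f ?_
  rintro ⟨⟨d, r, hs⟩, h⟩ ⟨⟨d', r', hs'⟩, h'⟩ e
  simp only [f, Sigma.mk.injEq, Fin.mk.injEq] at e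
  obtain ⟨rfl, e⟩ := e
  have e := eq_of_heq e
  have : r = r' := by
    funext i j
    have h2 := congrFun (congrFun e i) j
    simp only [Prod.mk.injEq, Fin.mk.injEq] at h2
    exact ofLex.injective (Prod.ext h2.1 h2.2)
  subst this
  rfl

end ColoredFrobeniusSymbol

/-- `cphi k n` is the number `cφ_k(n)` of `k`-colored generalized Frobenius partitions of `n`. -/
noncomputable def cphi (k n : ℕ) : ℕ :=
  Nat.card {s : ColoredFrobeniusSymbol k // s.size = n}

/-- The extension of `cφ_k` to rational arguments: it is `cφ_k(m)` at a non-negative integer `m`,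
and `0` at every other rational number. -/
noncomputable def cphiRat (k : ℕ) (x : ℚ) : ℕ :=
  if x.den = 1 ∧ 0 ≤ x then cphi k x.num.toNat else 0

/-! Record a symbol by the multiplicity `f (i, l)` of each value `l` in row `i`. Choosing the colors
gives `cphi k n` as the sum, over profiles `f`, of the products of the `k.choose (f x)`
(`cphi_eq_sum`).

If `p` does not divide some `f x`, equality of the row sums forces a second such entry. Each of the
two binomials is divisible by `p ^ a`, so the term vanishes modulo `p ^ (2 * a)`
(`prod_choose_dvd`). The other profiles are `p * g` with `g` a profile of `n / p`, and
`prod_choose_mul_modEq` compares their terms. For odd `p` this holds factor by factor. For `p = 2`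
there are signs, which cancel because the multiplicities have even sum, and a factor 2 lost at odd
entries, which is regained because two binomials are even. -/

/-! ### Binomial coefficients C(pM, pi) for odd p -/

/-- The product of `f j` over the `j < (q + 1) * i` that are not divisible by `q + 1`. -/
def blockProd (q i : ℕ) (f : ℤ → ℤ) : ℤ :=
  ∏ t ∈ Finset.range i, ∏ r ∈ Finset.range q, f ((q + 1) * t + r + 1)

theorem factorial_mul_eq_blockProd (q i : ℕ) :
    ((((q + 1) * i).factorial : ℕ) : ℤ) =
      (q + 1) ^ i * (i.factorial : ℤ) * blockProd q i (fun j => j) := by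
  have key : ∀ m : ℕ, ((((q + 1) * m + (q + 1)).factorial : ℕ) : ℤ) =
      (((q + 1) * m).factorial : ℤ) *
        ((∏ r ∈ Finset.range q, (((q : ℤ) + 1) * m + r + 1)) * ((q + 1) * (m + 1))) := by
    intro m
    rw [← Finset.prod_range_add_one_eq_factorial, ← Finset.prod_range_add_one_eq_factorial,
      Finset.prod_range_add, Finset.prod_range_succ]
    push_cast
    ring
  induction i with
  | zero => simp [blockProd]
  | succ m ih =>
    rw [Nat.mul_succ, key, ih, blockProd, blockProd, Finset.prod_range_succ, Nat.factorial_succ]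
    push_cast
    ring

theorem prod_sub_eq_blockProd (q i : ℕ) (M : ℤ) :
    ∏ j ∈ Finset.range ((q + 1) * i), ((q + 1) * M - (j : ℤ)) =
      (q + 1) ^ i * (∏ j ∈ Finset.range i, (M - (j : ℤ))) *
        blockProd q i (fun j => (q + 1) * M - j) := by
  induction i with
  | zero => simp [blockProd]
  | succ m ih =>
    rw [Nat.mul_succ, Finset.prod_range_add, ih, Finset.prod_range_succ' _ q, blockProd,
      blockProd, Finset.prod_range_succ, Finset.prod_range_succ]
    push_cast
    simp only [add_assoc]
    ring

theorem choose_mul_factorial_eq_prod (n r : ℕ) :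
    (n.choose r : ℤ) * r.factorial = ∏ j ∈ Finset.range r, ((n : ℤ) - j) := by
  have h : n.choose r * r.factorial = n.descFactorial r := by
    rw [Nat.descFactorial_eq_factorial_mul_choose, mul_comm]
  rw [← Nat.cast_mul, h, Nat.descFactorial_eq_prod_range]
  by_cases hr : r ≤ n
  · push_cast
    refine Finset.prod_congr rfl fun j hj => ?_
    rw [Finset.mem_range] at hj
    rw [Nat.cast_sub (by omega)]
  · push Not at hr
    rw [Finset.prod_eq_zero (Finset.mem_range.mpr hr) (by simp),
      Finset.prod_eq_zero (Finset.mem_range.mpr hr) (by simp)]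
    simp

/-- The multiples of `q + 1` in numerator and denominator reproduce C(M, i), their powers of `q + 1`
cancelling; the remaining factors form the two block products. -/
theorem choose_mul_blockProd (q M i : ℕ) :
    (((q + 1) * M).choose ((q + 1) * i) : ℤ) * blockProd q i (fun j => j) =
      (M.choose i : ℤ) * blockProd q i (fun j => (q + 1) * M - j) := by
  have h1 := choose_mul_factorial_eq_prod ((q + 1) * M) ((q + 1) * i)
  have h2 := choose_mul_factorial_eq_prod M i
  have h3 := prod_sub_eq_blockProd q i M
  rw [factorial_mul_eq_blockProd] at h1
  push_cast at h1
  rw [h3, ← h2] at h1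
  have hne : ((q : ℤ) + 1) ^ i * (i.factorial : ℤ) ≠ 0 := by positivity
  apply mul_left_cancel₀ hne
  linear_combination h1

theorem blockProd_reflect (q i : ℕ) (f : ℤ → ℤ) :
    blockProd q i (fun j => f ((q + 1) * i - j)) = blockProd q i f := by
  unfold blockProd
  rw [← Finset.prod_range_reflect]
  refine Finset.prod_congr rfl fun t ht => ?_
  rw [← Finset.prod_range_reflect]
  refine Finset.prod_congr rfl fun r hr => ?_
  rw [Finset.mem_range] at ht hr
  dsimp only
  congr 1
  rw [Nat.sub_sub, Nat.sub_sub, Nat.cast_sub (by omega), Nat.cast_sub (by omega)]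
  push_cast
  ring

theorem blockProd_mul (q i : ℕ) (f g : ℤ → ℤ) :
    blockProd q i f * blockProd q i g = blockProd q i (fun j => f j * g j) := by
  simp only [blockProd, ← Finset.prod_mul_distrib]

theorem blockProd_modEq (q i : ℕ) {m : ℤ} {f g : ℤ → ℤ} (h : ∀ j, f j ≡ g j [ZMOD m]) :
    blockProd q i f ≡ blockProd q i g [ZMOD m] :=
  Int.ModEq.prod fun _ _ => Int.ModEq.prod fun _ _ => h _

theorem blockProd_neg (q i : ℕ) (f : ℤ → ℤ) :
    blockProd q i (fun j => - f j) = (-1) ^ (q * i) * blockProd q i f := by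
  simp only [blockProd, Finset.prod_neg, Finset.prod_mul_distrib, Finset.card_range,
    Finset.prod_const]
  rw [pow_mul]

theorem isCoprime_blockProd {p q : ℕ} (hp : p.Prime) (hq : p = q + 1) (i : ℕ) :
    IsCoprime (p : ℤ) (blockProd q i (fun j => j)) := by
  refine IsCoprime.prod_right fun t _ => IsCoprime.prod_right fun r hr => ?_
  rw [Finset.mem_range] at hr
  have h : IsCoprime (p : ℤ) ((r + 1 : ℕ) : ℤ) := by
    rw [Nat.isCoprime_iff_coprime, hp.coprime_iff_not_dvd]
    exact Nat.not_dvd_of_pos_of_lt (by omega) (by omega)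
  have := h.add_mul_left_right (t : ℤ)
  have e : ((q : ℤ) + 1) * t + r + 1 = ((r + 1 : ℕ) : ℤ) + (p : ℤ) * t := by
    rw [hq]; push_cast; ring
  rwa [← e] at this

/-- Pair `j` with `(q + 1) * i - j`: the terms linear in `M * j` cancel, leaving a shift that
carries the square of `q + 1`. -/
theorem sq_blockProd_sub (q i : ℕ) (M : ℤ) :
    blockProd q i (fun j => (q + 1) * M - j) ^ 2 =
      blockProd q i (fun j => (q + 1) ^ 2 * (M * (M - i)) + j * ((q + 1) * i - j)) := by
  rw [sq]
  nth_rw 2 [← blockProd_reflect]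
  rw [blockProd_mul]
  refine Finset.prod_congr rfl fun t _ => Finset.prod_congr rfl fun r _ => ?_
  ring

theorem sq_blockProd_id (q i : ℕ) :
    blockProd q i (fun j => j) ^ 2 = blockProd q i (fun j => j * ((q + 1) * i - j)) := by
  rw [sq]
  nth_rw 2 [← blockProd_reflect]
  rw [blockProd_mul]

/-- Turns the factor `M - i` from the pairing into a second factor `M`. -/
theorem choose_mul_sub (M i : ℕ) :
    (M.choose i : ℤ) * (M - i) = M * ((M - 1).choose i : ℤ) := by
  rcases M with _ | M
  · rcases i with _ | i <;> simp
  · by_cases h : i ≤ M + 1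
    · have := Nat.choose_mul_succ_eq M i
      zify [h] at this
      push_cast
      linear_combination -this
    · push Not at h
      rw [Nat.choose_eq_zero_of_lt h, Nat.choose_eq_zero_of_lt (by omega)]
      simp

/-- For an odd prime `p` the binomial coefficients `C(pM, pi)` and `C(M, i)` agree modulo the
`p`-part of `(pM)²`. -/
theorem choose_prime_mul_modEq {p M a : ℕ} (hp : p.Prime) (hp2 : p ≠ 2) (hM : p ^ a ∣ p * M)
    (i : ℕ) :
    ((p * M).choose (p * i) : ℤ) ≡ (M.choose i : ℤ) [ZMOD (p : ℤ) ^ (2 * a)] := by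
  obtain ⟨q, rfl⟩ : ∃ q, p = q + 1 := ⟨p - 1, by have := hp.pos; omega⟩
  have hq : Even q := by
    have := hp.eq_two_or_odd'
    rw [Nat.odd_add_one, Nat.not_odd_iff_even] at this
    tauto
  set P := blockProd q i (fun j => j) with hP
  set P' := blockProd q i (fun j => (q + 1) * M - j) with hP'
  have hcop : IsCoprime ((q + 1 : ℕ) : ℤ) P := isCoprime_blockProd hp rfl i
  have hMz : ((q + 1 : ℕ) : ℤ) ^ a ∣ (q + 1) * M := by exact_mod_cast hM
  have h1 : ((q + 1 : ℤ) * M) ^ 2 ∣ (M.choose i : ℤ) * (P' ^ 2 - P ^ 2) := by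
    have : P' ^ 2 ≡ P ^ 2 [ZMOD (q + 1) ^ 2 * (M * (M - i))] := by
      rw [hP', hP, sq_blockProd_sub, sq_blockProd_id]
      refine blockProd_modEq q i fun j => ?_
      simp [Int.ModEq]
    obtain ⟨c, hc⟩ := this.symm.dvd
    rw [hc]
    exact ⟨((M - 1).choose i : ℤ) * c, by
      linear_combination (q + 1 : ℤ) ^ 2 * M * c * choose_mul_sub M i⟩
  have h2 : ((q + 1 : ℕ) : ℤ) ∣ P' - P := by
    have : P' ≡ P [ZMOD ((q + 1 : ℕ) : ℤ)] := by
      have e : P = blockProd q i (fun j => - j) := by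
        rw [blockProd_neg, Even.neg_one_pow (hq.mul_right i), one_mul]
      rw [e]
      refine blockProd_modEq q i fun j => ?_
      rw [Int.modEq_iff_dvd]
      exact ⟨-M, by push_cast; ring⟩
    exact this.symm.dvd
  -- Since `P' ≡ P`, the sum is `2 * P` modulo `p`, a unit for odd `p`; it can be cancelled from `P'
  -- ^ 2 - P ^ 2`.
  have h3 : IsCoprime ((q + 1 : ℕ) : ℤ) (P' + P) := by
    obtain ⟨c, hc⟩ := h2
    have h : IsCoprime ((q + 1 : ℕ) : ℤ) (2 * P) := by
      refine IsCoprime.mul_right ?_ hcop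
      have : Nat.Coprime (q + 1) 2 := by
        rw [Nat.coprime_primes hp Nat.prime_two]; exact hp2
      exact_mod_cast Nat.isCoprime_iff_coprime.mpr this
    have := h.add_mul_left_right c
    rwa [show 2 * P + ((q + 1 : ℕ) : ℤ) * c = P' + P by linear_combination -hc] at this
  have h4 : ((q + 1 : ℕ) : ℤ) ^ (2 * a) ∣
      ((((q + 1) * M).choose ((q + 1) * i) : ℤ) - (M.choose i : ℤ)) * (P * (P' + P)) := by
    have e := choose_mul_blockProd q M i
    have : ((((q + 1) * M).choose ((q + 1) * i) : ℤ) - (M.choose i : ℤ)) * (P * (P' + P)) =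
        (M.choose i : ℤ) * (P' ^ 2 - P ^ 2) := by
      linear_combination (P' + P) * e
    rw [this, mul_comm 2 a, pow_mul]
    exact (pow_dvd_pow_of_dvd hMz 2).trans h1
  exact (Int.modEq_iff_dvd.mpr
    ((IsCoprime.pow_left (hcop.mul_right h3)).dvd_of_dvd_mul_right h4)).symm

/-! ### Divisibility of binomial coefficients and the prime 2 -/

theorem choose_dvd_of_not_dvd {p a k : ℕ} (hp : p.Prime) (hk : p ^ a ∣ k) {i : ℕ}
    (hi : ¬ p ∣ i) : p ^ a ∣ k.choose i := by
  rcases k with _ | k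
  · rcases i with _ | i <;> simp at hi ⊢
  rcases i with _ | i
  · simp at hi
  have h := Nat.add_one_mul_choose_eq k i
  have h2 : p ^ a ∣ (k + 1).choose (i + 1) * (i + 1) := h ▸ hk.mul_right _
  exact (((hp.coprime_iff_not_dvd).mpr hi).pow_left a).dvd_of_dvd_mul_right h2

/-- Apply Pascal's rule twice: the middle term is twice an even number. This covers exponent 1,
where `M` may be odd. -/
theorem choose_two_mul_modEq_four (M i : ℕ) :
    ((2 * M).choose (2 * i) : ℤ) ≡ (M.choose i : ℤ) [ZMOD 4] := by
  induction M generalizing i with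
  | zero => rcases i with _ | i <;> simp [Nat.mul_succ]
  | succ M ih =>
    rcases i with _ | i
    · simp
    · have h1 := ih i
      have h2 := ih (i + 1)
      have h3 : 2 ∣ (2 * M).choose (2 * i + 1) := by
        have := choose_dvd_of_not_dvd (a := 1) (k := 2 * M) (i := 2 * i + 1) Nat.prime_two
          (by simp) (by omega)
        simpa using this
      have e : (2 * (M + 1)).choose (2 * (i + 1)) =
          (2 * M).choose (2 * i) + 2 * (2 * M).choose (2 * i + 1) +
            (2 * M).choose (2 * (i + 1)) := by
        rw [show 2 * (M + 1) = 2 * M + 1 + 1 by ring, show 2 * (i + 1) = 2 * i + 1 + 1 by ring,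
          Nat.choose_succ_succ, Nat.choose_succ_succ, Nat.choose_succ_succ]
        ring
      rw [e, Nat.choose_succ_succ, Nat.succ_eq_add_one]
      simp only [Int.ModEq] at h1 h2 ⊢
      push_cast
      omega

/-- Modulo `2 * X` the terms with `X ^ 2` vanish because `X` is even, and each linear term is `X`
times an odd number. -/
theorem prod_add_modEq_two_mul {ι : Type*} (s : Finset ι) (y : ι → ℤ) (hy : ∀ t ∈ s, Odd (y t))
    {X : ℤ} (hX : Even X) :
    ∏ t ∈ s, (X + y t) ≡ ∏ t ∈ s, y t + s.card * X [ZMOD 2 * X] := by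
  classical
  induction s using Finset.induction_on with
  | empty => simp
  | insert a s ha ih =>
    rw [Finset.prod_insert ha, Finset.prod_insert ha, Finset.card_insert_of_notMem ha]
    obtain ⟨c, hc⟩ := (ih fun t ht => hy t (Finset.mem_insert_of_mem ht)).dvd
    obtain ⟨b, hb⟩ := hy a (Finset.mem_insert_self _ _)
    obtain ⟨x, hx⟩ := hX
    obtain ⟨d, hd⟩ : Odd (∏ t ∈ s, y t) := by
      refine Finset.prod_induction _ Odd (fun _ _ => Odd.mul) odd_one
        fun t ht => hy t (Finset.mem_insert_of_mem ht)
    rw [Int.modEq_iff_dvd]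
    refine ⟨(X + y a) * c - d - s.card * x - b * s.card, ?_⟩
    push_cast
    linear_combination (X + y a) * hc - X * hd - X * s.card * hb - X * s.card * hx

theorem choose_two_mul_modEq {M a : ℕ} (hM2 : Even M) (hM : 2 ^ a ∣ 2 * M) (ha : 1 ≤ a) (i : ℕ) :
    ((2 * M).choose (2 * i) : ℤ) ≡ (-1) ^ i * (M.choose i : ℤ) [ZMOD 2 ^ (2 * a - 1)] ∧
    (Even i →
      ((2 * M).choose (2 * i) : ℤ) ≡ (-1) ^ i * (M.choose i : ℤ) [ZMOD 2 ^ (2 * a)]) := by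
  set P := blockProd 1 i (fun j => j) with hP
  set P' := blockProd 1 i (fun j => ((1 : ℕ) + 1) * M - j) with hP'
  set ε : ℤ := (-1) ^ i with hε
  have hε2 : ε * ε = 1 := by rw [hε, ← mul_pow]; simp
  have hcop : IsCoprime (2 : ℤ) P := by
    exact_mod_cast isCoprime_blockProd Nat.prime_two rfl i
  have hsq : P' ^ 2 ≡ P ^ 2 + i * (4 * (M * (M - i))) [ZMOD 2 * (4 * (M * (M - i)))] := by
    have hy : ∀ t ∈ Finset.range i,
        Odd ((((1 : ℕ) + 1) * t + (0 : ℕ) + 1 : ℤ) * (((1 : ℕ) + 1) * i -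
          (((1 : ℕ) + 1) * t + (0 : ℕ) + 1))) := by
      intro t _
      refine Odd.mul ⟨t, by push_cast; ring⟩ ⟨i - t - 1, by push_cast; ring⟩
    have h := prod_add_modEq_two_mul (Finset.range i) _ hy
      (X := 4 * (M * (M - i))) ⟨2 * (M * (M - i)), by ring⟩
    rw [hP', hP, sq_blockProd_sub, sq_blockProd_id]
    simp only [blockProd, Finset.prod_range_one, Finset.card_range] at h ⊢
    convert h using 4
    norm_num
  obtain ⟨s, hs⟩ := hsq.symm.dvd
  obtain ⟨r, hr⟩ : (2 * M : ℤ) ∣ P' - ε * P := by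
    have : P' ≡ ε * P [ZMOD 2 * M] := by
      have e : ε * P = blockProd 1 i (fun j => - j) := by
        rw [blockProd_neg, one_mul]
      rw [e]
      refine blockProd_modEq 1 i fun j => ?_
      rw [Int.modEq_iff_dvd]
      exact ⟨-1, by push_cast; ring⟩
    exact this.symm.dvd
  obtain ⟨m, hm⟩ := hM2
  have hmz : (M : ℤ) = m + m := by exact_mod_cast hm
  have e := choose_mul_blockProd 1 M i
  rw [show 1 + 1 = 2 from rfl] at e
  -- Here `P' + ε * P = 2 * (ε * P + M * r)`; the cofactor is odd because `M` is even, so only one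
  -- factor 2 is lost.
  have hcop' : IsCoprime (2 : ℤ) (P * (ε * P + M * r)) := by
    refine hcop.mul_right ?_
    have h1 : IsCoprime (2 : ℤ) (ε * P) :=
      IsCoprime.mul_right ⟨0, ε, by linear_combination hε2⟩ hcop
    have := h1.add_mul_left_right (m * r)
    rwa [show ε * P + 2 * (m * r) = ε * P + M * r by rw [hmz]; ring] at this
  have key : (((2 * M).choose (2 * i) : ℤ) - ε * (M.choose i : ℤ)) * (P * (ε * P + M * r)) =
      2 * M ^ 2 * (((M - 1).choose i : ℤ) * (i + 2 * s)) := by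
    apply mul_left_cancel₀ (two_ne_zero' ℤ)
    have hc := choose_mul_sub M i
    have e' : ((2 * M).choose (2 * i) : ℤ) * P = (M.choose i : ℤ) * P' := e
    have hrr : P' + ε * P = 2 * (ε * P + M * r) := by linear_combination hr
    calc 2 * ((((2 * M).choose (2 * i) : ℤ) - ε * (M.choose i : ℤ)) * (P * (ε * P + M * r)))
        = (((2 * M).choose (2 * i) : ℤ) * P - ε * (M.choose i : ℤ) * P) *
          (2 * (ε * P + M * r)) := by ring
      _ = (M.choose i : ℤ) * (P' ^ 2 - P ^ 2) := by
        rw [← hrr, e']; linear_combination (-(M.choose i : ℤ) * P ^ 2) * hε2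
      _ = 2 * (2 * M ^ 2 * (((M - 1).choose i : ℤ) * (i + 2 * s))) := by
        linear_combination (M.choose i : ℤ) * hs + 4 * M * (i + 2 * s) * hc
  have hMz : (2 : ℤ) ^ (2 * a) ∣ (2 * M) ^ 2 := by
    rw [mul_comm 2 a, pow_mul]
    exact pow_dvd_pow_of_dvd (by exact_mod_cast hM) 2
  constructor
  · refine (Int.modEq_iff_dvd.mpr
      ((IsCoprime.pow_left hcop').dvd_of_dvd_mul_right ?_)).symm
    rw [key]
    refine Dvd.dvd.mul_right ?_ _
    apply Int.dvd_of_mul_dvd_mul_left two_ne_zero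
    rw [← pow_succ', show 2 * a - 1 + 1 = 2 * a by omega]
    convert hMz using 1
    ring
  -- For even `i` the factor `i + 2 * s` in `key` restores the lost 2.
  · rintro ⟨b, hb⟩
    refine (Int.modEq_iff_dvd.mpr
      ((IsCoprime.pow_left hcop').dvd_of_dvd_mul_right ?_)).symm
    rw [key]
    refine hMz.trans ⟨((M - 1).choose i : ℤ) * (b + s), ?_⟩
    rw [hb]; push_cast; ring

/-! ### Counting symbols by multiplicity profiles -/

open Finset in
/-- The conditions on the numbers `f (i, l)` of entries equal to `l` in row `i` of a colored
Frobenius symbol of size `n`. -/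
def IsProfile (L n : ℕ) (f : Fin 2 × Fin L → ℕ) : Prop :=
  ∑ l, f (0, l) = ∑ l, f (1, l) ∧
    ∑ l, f (0, l) + (∑ l : Fin L, f (0, l) * l + ∑ l : Fin L, f (1, l) * l) = n

namespace ColoredFrobeniusSymbol

variable {k : ℕ}

/-- The colors with which `l` occurs in row `i` of a colored Frobenius symbol. -/
noncomputable def colors (L : ℕ) (s : ColoredFrobeniusSymbol k) (x : Fin 2 × Fin L) :
    Finset (Fin k) :=
  {c | ∃ j, s.row x.1 j = toLex ((x.2 : ℕ), c)}

theorem fst_row_lt {L : ℕ} (s : ColoredFrobeniusSymbol k) (hL : s.size < L) (i : Fin 2)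
    (j : Fin s.d) : (ofLex (s.row i j)).1 < L := by
  have h := Finset.single_le_sum
    (f := fun j : Fin s.d => (ofLex (s.row 0 j)).1 + (ofLex (s.row 1 j)).1)
    (fun _ _ => Nat.zero_le _) (Finset.mem_univ j)
  unfold size at hL
  fin_cases i <;> simp at h ⊢ <;> omega

/-- Strict decrease makes equal values in a row carry distinct colors. The weight 1 counts columns;
the identity weight gives the sum of the row. -/
theorem sum_card_colors {L : ℕ} (s : ColoredFrobeniusSymbol k) (hL : s.size < L) (i : Fin 2)
    (w : ℕ → ℕ) :
    ∑ l : Fin L, (s.colors L (i, l)).card * w l = ∑ j, w (ofLex (s.row i j)).1 := by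
  classical
  rw [← Finset.sum_fiberwise_of_maps_to (s := Finset.univ) (t := Finset.univ)
    (g := fun j : Fin s.d => (⟨(ofLex (s.row i j)).1, s.fst_row_lt hL i j⟩ : Fin L))
    (fun _ _ => Finset.mem_univ _)]
  refine Finset.sum_congr rfl fun l _ => ?_
  rw [Finset.sum_congr rfl (g := fun _ => w l), Finset.sum_const, smul_eq_mul]
  · congr 1
    symm
    refine Finset.card_bij (fun j _ => (ofLex (s.row i j)).2) ?_ ?_ ?_
    · intro j hj
      simp only [Finset.mem_filter, Finset.mem_univ, true_and, colors] at hj ⊢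
      exact ⟨j, by rw [← hj]; rfl⟩
    · intro j hj j' hj' e
      simp only [Finset.mem_filter, Finset.mem_univ, true_and] at hj hj'
      apply (s.row_strictAnti i).injective
      apply ofLex.injective
      exact Prod.ext (congrArg Fin.val (hj.trans hj'.symm)) e
    · intro c hc
      simp only [Finset.mem_filter, Finset.mem_univ, true_and, colors] at hc ⊢
      obtain ⟨j, hj⟩ := hc
      exact ⟨j, by ext; simp [hj], by simp [hj]⟩
  · intro j hj
    simp only [Finset.mem_filter, Finset.mem_univ, true_and] at hj
    rw [← hj]

theorem sum_card_colors_eq_d {L : ℕ} (s : ColoredFrobeniusSymbol k) (hL : s.size < L)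
    (i : Fin 2) : ∑ l : Fin L, (s.colors L (i, l)).card = s.d := by
  simpa using s.sum_card_colors hL i (fun _ => 1)

theorem isProfile_card_colors {L n : ℕ} (s : ColoredFrobeniusSymbol k) (hs : s.size = n)
    (hL : n < L) : IsProfile L n (fun x => (s.colors L x).card) := by
  subst hs
  refine ⟨by simp only [s.sum_card_colors_eq_d hL], ?_⟩
  have h := s.sum_card_colors hL
  dsimp only
  rw [s.sum_card_colors_eq_d hL, h 0 fun l => l, h 1 fun l => l, size, Finset.sum_add_distrib]

/-- A strictly decreasing row is determined by its set of entries, and `L` exceeds every value. -/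
theorem colors_injective {L : ℕ} {s s' : ColoredFrobeniusSymbol k} (hs : s.size < L)
    (hs' : s'.size < L) (h : s.colors L = s'.colors L) : s = s' := by
  have hd : s.d = s'.d := by
    rw [← s.sum_card_colors_eq_d hs 0, ← s'.sum_card_colors_eq_d hs' 0, h]
  have hsub : ∀ {s s' : ColoredFrobeniusSymbol k}, s.size < L → s.colors L = s'.colors L →
      ∀ i, Set.range (s.row i) ⊆ Set.range (s'.row i) := by
    rintro s s' hs h i _ ⟨j, rfl⟩
    have : (ofLex (s.row i j)).2 ∈ s.colors L (i, ⟨_, s.fst_row_lt hs i j⟩) := by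
      simp only [Finset.mem_filter, Finset.mem_univ, true_and, colors]
      exact ⟨j, rfl⟩
    rw [h] at this
    simp only [Finset.mem_filter, Finset.mem_univ, true_and, colors] at this
    exact this
  have hr : ∀ i, Set.range (s.row i) = Set.range (s'.row i) := fun i =>
    (hsub hs h i).antisymm (hsub hs' h.symm i)
  obtain ⟨d, r, hr1⟩ := s
  obtain ⟨d', r', hr2⟩ := s'
  dsimp only at hd hr
  subst hd
  congr 1
  funext i
  have h1 : StrictMono (OrderDual.toDual ∘ r i) := hr1 i
  have h2 : StrictMono (OrderDual.toDual ∘ r' i) := hr2 i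
  have := (h1.range_inj h2).mp (by rw [Set.range_comp, Set.range_comp, hr i])
  exact this

theorem exists_colors_eq {L n : ℕ} (g : Fin 2 × Fin L → Finset (Fin k))
    (hg : IsProfile L n (fun x => (g x).card)) :
    ∃ s : ColoredFrobeniusSymbol k, s.size = n ∧ s.colors L = g := by
  classical
  let emb : (Σ _ : Fin L, Fin k) ↪ ℕ ×ₗ Fin k :=
    ⟨fun x => toLex ((x.1 : ℕ), x.2), by
      rintro ⟨l, c⟩ ⟨l', c'⟩ h
      have h := toLex.injective h
      simp only [Prod.mk.injEq] at h
      obtain ⟨h1, rfl⟩ := h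
      obtain rfl := Fin.ext h1
      rfl⟩
  let A : Fin 2 → Finset (ℕ ×ₗ Fin k) := fun i =>
    (Finset.univ.sigma fun l => g (i, l)).map emb
  let d := ∑ l, (g (0, l)).card
  have hA : ∀ i, (A i).card = d := by
    intro i
    simp only [A, Finset.card_map, Finset.card_sigma]
    fin_cases i
    · rfl
    · exact hg.1.symm
  -- Each row lists its set in increasing order, reversed by `Fin.rev`.
  let s : ColoredFrobeniusSymbol k :=
    ⟨d, fun i j => (A i).orderEmbOfFin (hA i) j.rev, fun i =>
      ((A i).orderEmbOfFin (hA i)).strictMono.comp_strictAnti Fin.rev_strictAnti⟩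
  have hmem : ∀ i x, (∃ j, s.row i j = x) ↔ x ∈ A i := by
    intro i x
    rw [← Finset.mem_coe, ← Finset.range_orderEmbOfFin (A i) (hA i)]
    constructor
    · rintro ⟨j, rfl⟩; exact ⟨_, rfl⟩
    · rintro ⟨j, rfl⟩; exact ⟨j.rev, by simp [s]⟩
  have hc : s.colors L = g := by
    funext x
    ext c
    simp only [Finset.mem_filter, Finset.mem_univ, true_and, colors, hmem, A, Finset.mem_map,
      Finset.mem_sigma]
    constructor
    · rintro ⟨y, hy, e⟩
      have : emb y = emb ⟨x.2, c⟩ := e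
      rw [emb.injective this] at hy
      exact hy
    · intro h
      exact ⟨⟨x.2, c⟩, h, rfl⟩
  have hsum : ∀ i, ∑ j, (ofLex (s.row i j)).1 = ∑ l : Fin L, (g (i, l)).card * l := by
    intro i
    have e : ∑ j, (ofLex (s.row i j)).1 = ∑ x ∈ A i, (ofLex x).1 := by
      refine Finset.sum_bij (fun j _ => s.row i j) (fun j _ => (hmem i _).mp ⟨j, rfl⟩)
        (fun _ _ _ _ e => (s.row_strictAnti i).injective e) (fun x hx => ?_) (fun _ _ => rfl)
      obtain ⟨j, hj⟩ := (hmem i x).mpr hx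
      exact ⟨j, Finset.mem_univ _, hj⟩
    rw [e]
    simp only [A, Finset.sum_map, Finset.sum_sigma]
    refine Finset.sum_congr rfl fun l _ => ?_
    exact Finset.sum_const_nat fun _ _ => rfl
  refine ⟨s, ?_, hc⟩
  rw [size, Finset.sum_add_distrib, hsum, hsum]
  exact hg.2

end ColoredFrobeniusSymbol

theorem IsProfile.le {L n : ℕ} {f : Fin 2 × Fin L → ℕ} (h : IsProfile L n f) (x) : f x ≤ n := by
  obtain ⟨i, l⟩ := x
  have h0 := Finset.single_le_sum (f := fun l => f (0, l)) (fun _ _ => Nat.zero_le _)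
    (Finset.mem_univ l)
  have h1 := Finset.single_le_sum (f := fun l => f (1, l)) (fun _ _ => Nat.zero_le _)
    (Finset.mem_univ l)
  have := h.1
  have := h.2
  fin_cases i <;> simp at h0 h1 ⊢ <;> omega

open Classical in
/-- The number of colored Frobenius partitions as a sum of products of binomial coefficients. -/
theorem cphi_eq_sum {k n L B : ℕ} (hL : n < L) (hB : n < B) :
    cphi k n = ∑ f ∈ Fintype.piFinset (fun _ : Fin 2 × Fin L => Finset.range B) with
      IsProfile L n f, ∏ x, k.choose (f x) := by
  have h1 : cphi k n = Fintype.card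
      {g : Fin 2 × Fin L → Finset (Fin k) // IsProfile L n (fun x => (g x).card)} := by
    rw [cphi, ← Nat.card_eq_fintype_card]
    refine Nat.card_eq_of_bijective
      (fun s => ⟨s.1.colors L, s.1.isProfile_card_colors s.2 hL⟩) ⟨?_, ?_⟩
    · rintro ⟨s, hs⟩ ⟨s', hs'⟩ e
      exact Subtype.ext (ColoredFrobeniusSymbol.colors_injective (hs ▸ hL) (hs' ▸ hL)
        (congrArg Subtype.val e))
    · rintro ⟨g, hg⟩
      obtain ⟨s, hs, e⟩ := ColoredFrobeniusSymbol.exists_colors_eq g hg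
      exact ⟨⟨s, hs⟩, Subtype.ext e⟩
  -- Group the color sets by their cardinalities; a fiber is a product of `powersetCard`s.
  rw [h1, Fintype.card_subtype,
    Finset.card_eq_sum_card_fiberwise (f := fun g x => (g x).card)
      (t := {f ∈ Fintype.piFinset (fun _ : Fin 2 × Fin L => Finset.range B) | IsProfile L n f})]
  · refine Finset.sum_congr rfl fun f hf => ?_
    rw [Finset.mem_filter] at hf
    have : (Finset.filter (fun g : Fin 2 × Fin L → Finset (Fin k) => (fun x => (g x).card) = f)
        {g | IsProfile L n (fun x => (g x).card)}) =
        Fintype.piFinset (fun x => Finset.powersetCard (f x) Finset.univ) := by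
      ext g
      simp only [Finset.mem_filter, Finset.mem_univ, true_and, Fintype.mem_piFinset,
        Finset.mem_powersetCard, Finset.subset_univ]
      constructor
      · rintro ⟨_, rfl⟩ x; rfl
      · intro h
        obtain rfl : (fun x => (g x).card) = f := funext h
        exact ⟨hf.2, rfl⟩
    rw [this, Fintype.card_piFinset]
    simp
  · intro g hg
    simp only [Finset.coe_filter, Finset.mem_univ, true_and, Set.mem_ofPred_eq,
      Fintype.mem_piFinset, Finset.mem_range] at hg ⊢
    exact ⟨fun x => (hg.le x).trans_lt hB, hg⟩

/-! ### Congruences for the term of a profile -/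

open Finset in
theorem IsProfile.exists_ne_not_dvd {L n p : ℕ} {f : Fin 2 × Fin L → ℕ} (h : IsProfile L n f)
    {x : Fin 2 × Fin L} (hx : ¬ p ∣ f x) : ∃ y, y ≠ x ∧ ¬ p ∣ f y := by
  by_contra! hy
  -- With opposite signs on the rows the entries sum to zero, so a single entry not divisible by `p`
  -- is impossible.
  let s : Fin 2 × Fin L → ℤ := fun y => if y.1 = 0 then 1 else -1
  have hs : ∑ y, s y * f y = 0 := by
    rw [Fintype.sum_prod_type, Fin.sum_univ_two]
    have := h.1
    zify at this
    simp [s, this]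
  rw [← Finset.add_sum_erase _ _ (Finset.mem_univ x)] at hs
  have h1 : (p : ℤ) ∣ ∑ y ∈ Finset.univ.erase x, s y * f y :=
    Finset.dvd_sum fun y hyx =>
      (Int.natCast_dvd_natCast.mpr (hy y (Finset.ne_of_mem_erase hyx))).mul_left _
  have h2 : (p : ℤ) ∣ s x * f x := by
    rw [eq_neg_of_add_eq_zero_left hs]
    exact h1.neg_right
  apply hx
  rw [← Int.natCast_dvd_natCast]
  by_cases h0 : x.1 = 0
  · simpa [s, h0] using h2
  · simpa [s, h0] using h2

theorem IsProfile.dvd {L n p : ℕ} {f : Fin 2 × Fin L → ℕ} (h : IsProfile L n f)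
    (hf : ∀ x, p ∣ f x) : p ∣ n := by
  rw [← h.2]
  exact dvd_add (Finset.dvd_sum fun _ _ => hf _) (dvd_add
    (Finset.dvd_sum fun _ _ => (hf _).mul_right _) (Finset.dvd_sum fun _ _ => (hf _).mul_right _))

theorem isProfile_mul_iff {L n p : ℕ} (hp : 0 < p) {f : Fin 2 × Fin L → ℕ} :
    IsProfile L (p * n) (fun x => p * f x) ↔ IsProfile L n f := by
  simp only [IsProfile, mul_assoc, ← Finset.mul_sum, ← mul_add]
  rw [Nat.mul_right_inj hp.ne', Nat.mul_right_inj hp.ne']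

theorem IsProfile.even_sum {L n : ℕ} {f : Fin 2 × Fin L → ℕ} (h : IsProfile L n f) :
    Even (∑ x, f x) := by
  rw [Fintype.sum_prod_type, Fin.sum_univ_two, ← h.1]
  exact ⟨_, rfl⟩

theorem prod_choose_dvd {p a k L n : ℕ} (hp : p.Prime) (hk : p ^ a ∣ k)
    {f : Fin 2 × Fin L → ℕ} (h : IsProfile L n f) {x : Fin 2 × Fin L} (hx : ¬ p ∣ f x) :
    p ^ (2 * a) ∣ ∏ x, k.choose (f x) := by
  obtain ⟨y, hyx, hy⟩ := h.exists_ne_not_dvd hx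
  rw [← Finset.mul_prod_erase _ _ (Finset.mem_univ x),
    ← Finset.mul_prod_erase _ _ (Finset.mem_erase.mpr ⟨hyx, Finset.mem_univ y⟩), ← mul_assoc,
    two_mul, pow_add]
  exact (mul_dvd_mul (choose_dvd_of_not_dvd hp hk hx) (choose_dvd_of_not_dvd hp hk hy)).mul_right _

/-- If the factors agree modulo the even number `m` and at least two of them are even, then the
products agree modulo `2 * m`. -/
theorem prod_modEq_two_mul_of_even {ι : Type*} [Fintype ι] {u v : ι → ℤ} {m : ℤ} (hm : Even m)
    (huv : ∀ x, u x ≡ v x [ZMOD m]) {x y : ι} (hyx : y ≠ x) (hx : Even (v x)) (hy : Even (v y)) :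
    ∏ x, u x ≡ ∏ x, v x [ZMOD 2 * m] := by
  classical
  rw [← Finset.mul_prod_erase _ u (Finset.mem_univ x),
    ← Finset.mul_prod_erase _ u (Finset.mem_erase.mpr ⟨hyx, Finset.mem_univ y⟩),
    ← Finset.mul_prod_erase _ v (Finset.mem_univ x),
    ← Finset.mul_prod_erase _ v (Finset.mem_erase.mpr ⟨hyx, Finset.mem_univ y⟩)]
  have hw : ∏ z ∈ (Finset.univ.erase x).erase y, u z ≡
      ∏ z ∈ (Finset.univ.erase x).erase y, v z [ZMOD m] := Int.ModEq.prod fun z _ => huv z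
  obtain ⟨c, hc⟩ := (huv x).symm.dvd
  obtain ⟨d, hd⟩ := (huv y).symm.dvd
  obtain ⟨w, hw⟩ := hw.symm.dvd
  obtain ⟨b, hb⟩ := hm
  obtain ⟨e, he⟩ := hx
  obtain ⟨f, hf⟩ := hy
  set U := ∏ z ∈ (Finset.univ.erase x).erase y, u z
  set V := ∏ z ∈ (Finset.univ.erase x).erase y, v z
  have hU : U = V + m * w := by linear_combination hw
  have hux : u x = v x + m * c := by linear_combination hc
  have huy : u y = v y + m * d := by linear_combination hd
  refine (Int.modEq_iff_dvd.mpr ⟨(e * d + f * c + b * c * d) * (V + m * w) + 2 * e * f * w, ?_⟩).symm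
  rw [hux, huy, he, hf, hU]
  linear_combination m * c * d * (V + m * w) * hb

theorem prod_choose_mul_modEq {p M a L n : ℕ} (hp : p.Prime) (hM : p ^ a ∣ p * M)
    {f : Fin 2 × Fin L → ℕ} (h : IsProfile L n f) :
    (∏ x, ((p * M).choose (p * f x) : ℤ)) ≡ ∏ x, (M.choose (f x) : ℤ)
      [ZMOD (p : ℤ) ^ (2 * a)] := by
  by_cases hp2 : p = 2
  · subst hp2
    rcases Nat.lt_or_ge a 2 with ha | ha
    · refine Int.ModEq.of_dvd ?_
        (Int.ModEq.prod fun x _ => choose_two_mul_modEq_four M (f x))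
      exact (pow_dvd_pow (2 : ℤ) (show 2 * a ≤ 2 by omega)).trans (by norm_num)
    · have hM' : 2 ∣ M := by
        obtain ⟨b, rfl⟩ : ∃ b, a = b + 2 := ⟨a - 2, by omega⟩
        rw [pow_succ'] at hM
        exact (dvd_pow_self 2 (by omega)).trans (Nat.dvd_of_mul_dvd_mul_left two_pos hM)
      have hMe : Even M := even_iff_two_dvd.mpr hM'
      -- The signs can be inserted freely since the total multiplicity is even.
      have e : ∏ x, (M.choose (f x) : ℤ) = ∏ x, ((-1) ^ f x * (M.choose (f x) : ℤ)) := by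
        rw [Finset.prod_mul_distrib, Finset.prod_pow_eq_pow_sum, h.even_sum.neg_one_pow, one_mul]
      have key := choose_two_mul_modEq hMe hM (by omega)
      rw [e]
      by_cases hf : ∀ x, Even (f x)
      · exact Int.ModEq.prod fun x _ => (key (f x)).2 (hf x)
      · push Not at hf
        obtain ⟨x, hx⟩ := hf
        have hx2 : ¬ 2 ∣ f x := by rwa [← even_iff_two_dvd]
        obtain ⟨y, hyx, hy⟩ := h.exists_ne_not_dvd hx2
        have hev : ∀ z, ¬ 2 ∣ f z → Even ((-1) ^ f z * (M.choose (f z) : ℤ)) := by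
          intro z hz
          refine Even.mul_left ?_ _
          have := choose_dvd_of_not_dvd (a := 1) Nat.prime_two (by simpa using hM') hz
          exact_mod_cast even_iff_two_dvd.mpr (by simpa using this)
        have hm : Even ((2 : ℤ) ^ (2 * a - 1)) := even_two.pow_of_ne_zero (by omega)
        have := prod_modEq_two_mul_of_even hm (fun z => (key (f z)).1) hyx (hev x hx2) (hev y hy)
        rwa [← pow_succ', show 2 * a - 1 + 1 = 2 * a by omega] at this
  · exact Int.ModEq.prod fun x _ => choose_prime_mul_modEq hp hp2 hM (f x)

/-! ### Congruences for the counting function -/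

theorem cphi_modEq_zero {p a k n : ℕ} (hp : p.Prime) (hk : p ^ a ∣ k) (hn : ¬ p ∣ n) :
    cphi k n ≡ 0 [MOD p ^ (2 * a)] := by
  classical
  rw [cphi_eq_sum n.lt_succ_self n.lt_succ_self, Nat.modEq_zero_iff_dvd]
  refine Finset.dvd_sum fun f hf => ?_
  have hf := (Finset.mem_filter.mp hf).2
  obtain ⟨x, hx⟩ : ∃ x, ¬ p ∣ f x := by
    by_contra! h
    exact hn (hf.dvd h)
  exact prod_choose_dvd hp hk hf hx

theorem cphi_mul_modEq {p a M : ℕ} (hp : p.Prime) (hM : p ^ a ∣ p * M) (n : ℕ) :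
    cphi (p * M) (p * n) ≡ cphi M n [MOD p ^ (2 * a)] := by
  classical
  have hn : n < p * n + 1 := Nat.lt_succ_of_le (Nat.le_mul_of_pos_left n hp.pos)
  -- Both sums use the same `L`, and the bounds `p * (n + 1)` and `n + 1` make multiplication by `p`
  -- a bijection onto the profiles divisible by `p`.
  rw [cphi_eq_sum (p * n).lt_succ_self (B := p * (n + 1))
    ((Nat.mul_lt_mul_left hp.pos).mpr n.lt_succ_self), cphi_eq_sum hn n.lt_succ_self,
    ← Finset.sum_filter_add_sum_filter_not _ (fun f => ∀ x, p ∣ f x)]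
  have h0 : ∀ s : ℕ, p ^ (2 * a) ∣ s → ∀ {t u : ℕ}, t ≡ u [MOD p ^ (2 * a)] →
      t + s ≡ u [MOD p ^ (2 * a)] := fun s hs t u h => by
    simpa using h.add ((Nat.modEq_zero_iff_dvd).mpr hs)
  apply h0
  · refine Finset.dvd_sum fun f hf => ?_
    obtain ⟨hf, hx⟩ := Finset.mem_filter.mp hf
    push Not at hx
    obtain ⟨x, hx⟩ := hx
    exact prod_choose_dvd hp hM (Finset.mem_filter.mp hf).2 hx
  · rw [← Finset.sum_bij (s := {f ∈ Fintype.piFinset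
        (fun _ : Fin 2 × Fin (p * n).succ => Finset.range n.succ) | IsProfile (p * n).succ n f})
      (f := fun f => ∏ x, (p * M).choose (p * f x)) (fun f _ x => p * f x)]
    · rw [← Int.natCast_modEq_iff]
      push_cast
      refine Int.ModEq.sum fun f hf => prod_choose_mul_modEq hp hM (Finset.mem_filter.mp hf).2
    · intro f hf
      simp only [Finset.mem_filter, Fintype.mem_piFinset, Finset.mem_range] at hf ⊢
      exact ⟨⟨fun x => (Nat.mul_lt_mul_left hp.pos).mpr (hf.1 x),
        (isProfile_mul_iff hp.pos).mpr hf.2⟩, fun x => dvd_mul_right _ _⟩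
    · intro f _ g _ e
      funext x
      exact Nat.eq_of_mul_eq_mul_left hp.pos (congrFun e x)
    · intro f hf
      simp only [Finset.mem_filter, Fintype.mem_piFinset, Finset.mem_range] at hf
      obtain ⟨⟨h1, h2⟩, h3⟩ := hf
      choose g hg using h3
      obtain rfl : f = fun x => p * g x := funext hg
      refine ⟨g, ?_, rfl⟩
      simp only [Finset.mem_filter, Fintype.mem_piFinset, Finset.mem_range]
      exact ⟨fun x => (Nat.mul_lt_mul_left hp.pos).mp (h1 x), (isProfile_mul_iff hp.pos).mp h2⟩
    · intro f _
      rfl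

theorem cphiRat_natCast (k n : ℕ) : cphiRat k (n : ℚ) = cphi k n := by
  simp [cphiRat]

theorem cphiRat_div_of_not_dvd {p n : ℕ} (hp : p ≠ 0) (h : ¬ p ∣ n) (k : ℕ) :
    cphiRat k ((n : ℚ) / p) = 0 := by
  rw [cphiRat, if_neg]
  rintro ⟨hd, -⟩
  exact h ((Rat.den_div_natCast_eq_one_iff n p hp).mp hd)

theorem theorem5p3 (p N α : ℕ) (hp : p.Prime) (hN : 0 < N) (hpN : ¬ p ∣ N) (hα : 1 ≤ α) :
    (∀ n : ℕ,
      cphi (p ^ α * N) n ≡ cphiRat (p ^ (α - 1) * N) ((n : ℚ) / (p : ℚ)) [MOD p ^ (2 * α)]) ∧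
    (∀ n r : ℕ, 1 ≤ r → r ≤ p - 1 →
      cphi (p ^ α * N) (p * n + r) ≡ 0 [MOD p ^ (2 * α)]) ∧
    (∀ n : ℕ,
      cphi (p ^ α * N) (p * n) ≡ cphi (p ^ (α - 1) * N) n [MOD p ^ (2 * α)]) := by
  have e : p ^ α * N = p * (p ^ (α - 1) * N) := by
    rw [← mul_assoc, ← pow_succ', Nat.sub_add_cancel hα]
  have h3 : ∀ n : ℕ,
      cphi (p ^ α * N) (p * n) ≡ cphi (p ^ (α - 1) * N) n [MOD p ^ (2 * α)] := fun n => by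
    have hd : p ^ α ∣ p * (p ^ (α - 1) * N) := ⟨N, e.symm⟩
    rw [e]
    exact cphi_mul_modEq hp hd n
  refine ⟨fun n => ?_, fun n r hr hr' => ?_, h3⟩
  · by_cases h : p ∣ n
    · obtain ⟨m, rfl⟩ := h
      have hm : ((p * m : ℕ) : ℚ) / p = (m : ℚ) := by
        have : (p : ℚ) ≠ 0 := by exact_mod_cast hp.ne_zero
        push_cast
        field_simp
      rw [hm, cphiRat_natCast]
      exact h3 m
    · rw [cphiRat_div_of_not_dvd hp.ne_zero h]
      exact cphi_modEq_zero hp (dvd_mul_right _ _) h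
  · refine cphi_modEq_zero hp (dvd_mul_right _ _) fun h => ?_
    have := Nat.le_of_dvd hr ((Nat.dvd_add_right (dvd_mul_right p n)).mp h)
    have := hp.pos
    omega
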